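/- Circuit model (indivisible model). A circuit is acyclic and has two disjoint sorts of wires: bit wires, and payload wires, each carrying a $w$-bit string. It consists of generalized boolean gates, each computing an arbitrary truth table from at most $3$ input bit wires to at most $3$ output bit wires, and of $w$-selector gates, which on a bit $b$ and two payloads $m_0,m_1$ output $m_b$. Reverse selector gates, which on a bit $b$ and a payload $m$ output $(m,0^w)$ if $b=0$ and $(0^w,m)$ if $b=1$, are allowed as well and are counted as selector gates. A wire may be fed into any number of gates. Thus boolean gates never read payloads; payloads are only moved by (reverse) selector gates. Loose swapper. Let $n,w\ge 0$ be integers. The input is an array of $n$ elements, each consisting of a $w$-bit payload and a label in $\{\mathtt{blue},\mathtt{red},\bot\}$ encoded by two bits: the first bit says whether the element is colored (label $\neq\bot$), and the second picks the color if it is colored. An array $\mathbf O$ is a *legal swap* of an array $\mathbf I$ if there are pairs of indices $(i_1,j_1),\dots,(i_\ell,j_\ell)$, all $2\ell$ indices being distinct, such that for each $k$ the elements $\mathbf I[i_k]$ and $\mathbf I[j_k]$ are colored with opposite colors, and $\mathbf O$ is obtained from $\mathbf I$ by swapping $\mathbf I[i_k]$ with $\mathbf I[j_k]$ for every $k$ and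 relabeling all swapped elements with $\bot$. A circuit *realizes an $(n,w)$-loose swapper* if, on every input array $\mathbf I$ in which the number of $\mathtt{red}$ elements equals the number of $\mathtt{blue}$ elements, it outputs a legal swap of $\mathbf I$ in which at most $n/128$ elements are colored. Theorem. There are constants $C_1,C_2$ such that for all $n$ and $w$ there exists a circuit in the indivisible model with at most $C_1 n$ generalized boolean gates and at most $C_2 n$ $w$-selector gates that realizes an $(n,w)$-loose swapper. -/

import Mathlib

/-- A circuit in the indivisible model, given as a list of gates in topological order.
There are two disjoint sorts of wires: bit wires, indexed by `β`, and payload wires, indexed by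
`π`, each carrying a `w`-bit string. Every gate adds its output wires to those
already available; a wire may be used any number of times. Boolean gates read and write bit wires
only, so that payloads can only be moved, by selector and reverse selector gates.
`Bout` and `Pout` index the bits and the payloads that the circuit outputs. -/
inductive Circuit (Bout Pout : Type) : Type → Type → Type 1
  /-- No more gates: choose the wire on which each output bit and each output payload is read. -/
  | output {β π : Type} (bit : Bout → β) (pay : Pout → π) : Circuit Bout Pout β π
  /-- A generalized boolean gate: an arbitrary truth table from `a ≤ 3` input bits
  to `c ≤ 3` output bits. -/
  | bool {β π : Type} (a c : ℕ) (ha : a ≤ 3) (hc : c ≤ 3) (ins : Fin a → β)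
      (table : (Fin a → Bool) → (Fin c → Bool)) (rest : Circuit Bout Pout (β ⊕ Fin c) π) :
      Circuit Bout Pout β π
  /-- A selector gate: outputs the payload on `m₀` if the bit on `b` is `0`, else that on `m₁`. -/
  | selector {β π : Type} (b : β) (m₀ m₁ : π) (rest : Circuit Bout Pout β (π ⊕ Fin 1)) :
      Circuit Bout Pout β π
  /-- A reverse selector gate: outputs `(m, 0)` if the bit on `b` is `0`, and `(0, m)` if it is
  `1`, where `m` is the payload on the given wire and `0` the all-zero string. -/
  | reverseSelector {β π : Type} (b : β) (m : π) (rest : Circuit Bout Pout β (π ⊕ Fin 2)) :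
      Circuit Bout Pout β π

namespace Circuit

variable {Bout Pout : Type}

/-- The output bits and output payloads of a circuit, from the values on the available wires. -/
def eval {w : ℕ} : {β π : Type} → Circuit Bout Pout β π → (β → Bool) → (π → BitVec w) →
    (Bout → Bool) × (Pout → BitVec w)
  | _, _, output bit pay, x, y => (fun o => x (bit o), fun o => y (pay o))
  | _, _, bool _ _ _ _ ins table rest, x, y =>
      rest.eval (Sum.elim x (table fun i => x (ins i))) y
  | _, _, selector b m₀ m₁ rest, x, y =>
      rest.eval x (Sum.elim y fun _ => if x b then y m₁ else y m₀)
  | _, _, reverseSelector b m rest, x, y =>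
      rest.eval x (Sum.elim y (if x b then ![0, y m] else ![y m, 0]))

/-- The number of generalized boolean gates. -/
def numBool : {β π : Type} → Circuit Bout Pout β π → ℕ
  | _, _, output _ _ => 0
  | _, _, bool _ _ _ _ _ _ rest => rest.numBool + 1
  | _, _, selector _ _ _ rest => rest.numBool
  | _, _, reverseSelector _ _ rest => rest.numBool

/-- The number of selector gates; reverse selector gates are counted as well. -/
def numSelector : {β π : Type} → Circuit Bout Pout β π → ℕ
  | _, _, output _ _ => 0
  | _, _, bool _ _ _ _ _ _ rest => rest.numSelector
  | _, _, selector _ _ _ rest => rest.numSelector + 1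
  | _, _, reverseSelector _ _ rest => rest.numSelector + 1

end Circuit

/-- The mark of an element. -/
inductive Label
  | uncolored
  | blue
  | red
  deriving DecidableEq

/-- The label encoded by two bits: the first says whether the element is colored, and, if it is,
the second picks the color. -/
def Label.ofBits : Bool → Bool → Label
  | false, _ => uncolored
  | true, false => blue
  | true, true => red

/-- An element: a label together with a `w`-bit payload string. -/
structure Element (w : ℕ) where
  label : Label
  payload : BitVec w

/-- Two labels are colored and have opposite colors. -/
def Label.Opposite (a b : Label) : Prop :=
  (a = blue ∧ b = red) ∨ (a = red ∧ b = blue)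

/-- `O` is obtained from `I` by choosing pairs `(i 0, j 0), …, (i (l - 1), j (l - 1))` of indices,
all distinct, such that the two elements of each pair are colored with opposite colors, swapping
the two elements of each pair, and uncoloring all swapped elements. -/
def LegalSwap {n w : ℕ} (I O : Fin n → Element w) : Prop :=
  ∃ (l : ℕ) (i j : Fin l → Fin n),
    Function.Injective (Sum.elim i j) ∧
    (∀ k, Label.Opposite (I (i k)).label (I (j k)).label) ∧
    (∀ k, O (i k) = ⟨Label.uncolored, (I (j k)).payload⟩) ∧
    (∀ k, O (j k) = ⟨Label.uncolored, (I (i k)).payload⟩) ∧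
    (∀ m, (∀ k, m ≠ i k ∧ m ≠ j k) → O m = I m)

/-- The number of elements of the array with a given label. -/
def numLabel {n w : ℕ} (c : Label) (A : Fin n → Element w) : ℕ :=
  (Finset.univ.filter fun m => (A m).label = c).card

/-- The number of colored elements of the array. -/
def numColored {n w : ℕ} (A : Fin n → Element w) : ℕ :=
  (Finset.univ.filter fun m => (A m).label ≠ Label.uncolored).card

/-- The array of `n` elements given by `2 n` label bits, bits `(m, 0)` and `(m, 1)` being the first
and the second label bit of the element `m`, and `n` payloads. -/
def arrayOf {n w : ℕ} (v : (Fin n × Fin 2 → Bool) × (Fin n → BitVec w)) : Fin n → Element w :=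
  fun m => ⟨Label.ofBits (v.1 (m, 0)) (v.1 (m, 1)), v.2 m⟩

/-- The circuit realizes an `(n, w)`-loose swapper: on every input array with as many red as
blue elements, it outputs a legal swap of it with at most `n / 128` colored elements. -/
def IsLooseSwapper (n w : ℕ)
    (Γ : Circuit (Fin n × Fin 2) (Fin n) (Fin n × Fin 2) (Fin n)) : Prop :=
  ∀ (x : Fin n × Fin 2 → Bool) (y : Fin n → BitVec w),
    numLabel Label.red (arrayOf (x, y)) = numLabel Label.blue (arrayOf (x, y)) →
      LegalSwap (arrayOf (x, y)) (arrayOf (Γ.eval x y)) ∧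
      (numColored (arrayOf (Γ.eval x y)) : ℝ) ≤ (n : ℝ) / 128

/-! Fix a list of linearly many pairs of positions and process it greedily: swap and uncolor a pair
whenever its colors are opposite. Labels only ever disappear, so at the end no listed pair has
opposite colors (`not_opposite_foldl_of_mem`). Each swap removes one red and one blue; if more than
`n / 128` elements stayed colored, both color classes would exceed `n / 256`, so a list meeting all
products of two sets this large gives a contradiction. Such a list exists by a derandomized union
bound over the `4 ^ n` pairs of sets (`exists_list_meets_large_sets`). Each pair costs two boolean
and two selector gates. -/

open Finset in
/-- Averaging: if every pair in a finite family has density at least `1 / K`, then a list of `m`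
points can be chosen such that at most a `(1 - 1 / K) ^ m` fraction of the family is not hit. -/
theorem exists_list_few_unhit {α ι : Type*} [Fintype α] [DecidableEq α] [DecidableEq ι]
    (K : ℕ) (hK : 0 < K) (T : ι → Finset α) (S : Finset ι)
    (hT : ∀ s ∈ S, Fintype.card α ≤ K * (T s).card) (hα : 0 < Fintype.card α) (m : ℕ) :
    ∃ L : List α, L.length = m ∧
      (S.filter fun s => ∀ e ∈ L, e ∉ T s).card * K ^ m ≤ S.card * (K - 1) ^ m := by
  induction m with
  | zero => exact ⟨[], rfl, by simp⟩
  | succ m ih =>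
    obtain ⟨L, hL, hc⟩ := ih
    set U := S.filter fun s => ∀ e ∈ L, e ∉ T s with hU
    have hsum : ∑ e : α, K * (U.filter fun s => e ∈ T s).card = ∑ s ∈ U, K * (T s).card := by
      rw [← mul_sum, ← mul_sum]
      congr 1
      simp_rw [card_filter]
      rw [sum_comm]
      refine sum_congr rfl fun s _ => ?_
      simp
    have hle : ∑ _e : α, U.card ≤ ∑ e : α, K * (U.filter fun s => e ∈ T s).card := by
      rw [hsum, sum_const, smul_eq_mul, card_univ, mul_comm, ← smul_eq_mul, ← sum_const]
      exact sum_le_sum fun s hs => hT s (mem_filter.1 hs).1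
    have : Nonempty α := Fintype.card_pos_iff.1 hα
    -- By double counting, some point hits at least `1 / K` of the sets still unhit.
    obtain ⟨e, -, he⟩ := exists_le_of_sum_le univ_nonempty hle
    refine ⟨e :: L, by simp [hL], ?_⟩
    have hset : (S.filter fun s => ∀ f ∈ e :: L, f ∉ T s) = U.filter fun s => e ∉ T s := by
      ext s
      simp only [mem_filter, List.mem_cons, forall_eq_or_imp, hU]
      tauto
    have hadd := card_filter_add_card_filter_not (s := U) (fun s => e ∈ T s)
    rw [hset]
    obtain ⟨k, rfl⟩ : ∃ k, K = k + 1 := ⟨K - 1, by omega⟩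
    simp only [Nat.add_sub_cancel] at hc ⊢
    have h1 : (U.filter fun s => e ∉ T s).card * (k + 1) ≤ U.card * k := by
      nlinarith
    calc (U.filter fun s => e ∉ T s).card * (k + 1) ^ (m + 1)
        = (U.filter fun s => e ∉ T s).card * (k + 1) * (k + 1) ^ m := by ring
      _ ≤ U.card * k * (k + 1) ^ m := Nat.mul_le_mul_right _ h1
      _ = U.card * (k + 1) ^ m * k := by ring
      _ ≤ S.card * k ^ m * k := Nat.mul_le_mul_right _ hc
      _ = S.card * k ^ (m + 1) := by ring

theorem exists_list_hitting {α ι : Type*} [Fintype α] [DecidableEq α] [DecidableEq ι]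
    (K : ℕ) (hK : 0 < K) (T : ι → Finset α) (S : Finset ι)
    (hT : ∀ s ∈ S, Fintype.card α ≤ K * (T s).card) (hα : 0 < Fintype.card α) (m : ℕ)
    (hS : S.card * (K - 1) ^ m < K ^ m) :
    ∃ L : List α, L.length = m ∧ ∀ s ∈ S, ∃ e ∈ L, e ∈ T s := by
  obtain ⟨L, hL, hc⟩ := exists_list_few_unhit K hK T S hT hα m
  refine ⟨L, hL, fun s hs => ?_⟩
  by_contra! hne
  have hmem : s ∈ S.filter fun s => ∀ e ∈ L, e ∉ T s := Finset.mem_filter.2 ⟨hs, hne⟩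
  have hpos := Finset.card_pos.2 ⟨s, hmem⟩
  exact (hc.trans_lt hS).not_ge (Nat.le_mul_of_pos_left _ hpos)

/-- With `K = k + 1`, Bernoulli gives `(1 + 1/k) ^ (k + 1) ≥ 2 + 1/k > 2`; denominators are cleared.
-/
theorem two_mul_pred_pow_lt_pow (K : ℕ) (hK : 2 ≤ K) : 2 * (K - 1) ^ K < K ^ K := by
  obtain ⟨k, rfl⟩ : ∃ k, K = k + 1 := ⟨K - 1, by omega⟩
  have hk : 0 < k := by omega
  have bernoulli : ∀ m, k ^ m * (k + m) ≤ k * (k + 1) ^ m := by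
    intro m
    induction m with
    | zero => simp
    | succ m ih =>
      calc k ^ (m + 1) * (k + (m + 1)) = k ^ m * (k * (k + (m + 1))) := by ring
        _ ≤ k ^ m * ((k + m) * (k + 1)) := Nat.mul_le_mul_left _ (by nlinarith)
        _ = k ^ m * (k + m) * (k + 1) := by ring
        _ ≤ k * (k + 1) ^ m * (k + 1) := Nat.mul_le_mul_right _ ih
        _ = k * (k + 1) ^ (m + 1) := by ring
  have h := bernoulli (k + 1)
  have hpos : 0 < k ^ (k + 1) := by positivity
  rw [Nat.add_sub_cancel]
  refine lt_of_mul_lt_mul_left (a := k) ?_ hk.le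
  nlinarith

theorem four_pow_mul_pred_pow_lt_pow (K : ℕ) (hK : 2 ≤ K) (n : ℕ) (hn : 0 < n) :
    2 ^ (2 * n) * (K - 1) ^ (2 * K * n) < K ^ (2 * K * n) := by
  have h := Nat.pow_lt_pow_left (two_mul_pred_pow_lt_pow K hK) (show 2 * n ≠ 0 by omega)
  rwa [mul_pow, ← pow_mul, ← pow_mul, show K * (2 * n) = 2 * K * n by ring] at h

open Finset in
/-- There are `n`-vertex graphs with linearly many edges which have an edge between any two sets
of at least `n / D` vertices each. -/
theorem exists_list_meets_large_sets (D : ℕ) (hD : 2 ≤ D) (n : ℕ) :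
    ∃ L : List (Fin n × Fin n), L.length = 2 * D ^ 2 * n ∧
      ∀ A B : Finset (Fin n), A.Nonempty → n ≤ D * A.card → n ≤ D * B.card →
        ∃ e ∈ L, e.1 ∈ A ∧ e.2 ∈ B := by
  -- Only for `n = 0` is nonemptiness of `A` needed: there empty sets satisfy the size bounds.
  rcases Nat.eq_zero_or_pos n with rfl | hn
  · exact ⟨[], by simp, fun A B ⟨a, _⟩ => a.elim0⟩
  have hK : 2 ≤ D ^ 2 := by nlinarith
  let S : Finset (Finset (Fin n) × Finset (Fin n)) :=
    univ.filter fun s => n ≤ D * s.1.card ∧ n ≤ D * s.2.card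
  have hScard : S.card ≤ 2 ^ (2 * n) := by
    refine (card_le_univ S).trans (le_of_eq ?_)
    simp [Fintype.card_prod, two_mul, pow_add]
  obtain ⟨L, hL, hit⟩ := exists_list_hitting (D ^ 2) (by omega) (fun s => s.1 ×ˢ s.2) S
    (by
      intro s hs
      obtain ⟨h1, h2⟩ := (mem_filter.1 hs).2
      simp only [Fintype.card_prod, Fintype.card_fin, card_product]
      calc n * n ≤ (D * s.1.card) * (D * s.2.card) := Nat.mul_le_mul h1 h2
        _ = _ := by ring)
    (by simp only [Fintype.card_prod, Fintype.card_fin]; positivity) (2 * D ^ 2 * n)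
    ((Nat.mul_le_mul_right _ hScard).trans_lt (four_pow_mul_pred_pow_lt_pow (D ^ 2) hK n hn))
  refine ⟨L, hL, fun A B _ hA hB => ?_⟩
  obtain ⟨e, he, hmem⟩ := hit (A, B) (mem_filter.2 ⟨mem_univ _, hA, hB⟩)
  exact ⟨e, he, mem_product.1 hmem⟩

/-! ### Greedy swapping along a list of pairs -/

instance (a b : Label) : Decidable (a.Opposite b) := by
  unfold Label.Opposite; infer_instance

/-- Swap and uncolor the elements at the ends of `e` if they have opposite colors. -/
def swapStep {n w : ℕ} (A : Fin n → Element w) (e : Fin n × Fin n) : Fin n → Element w :=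
  if (A e.1).label.Opposite (A e.2).label then
    Function.update (Function.update A e.1 ⟨.uncolored, (A e.2).payload⟩) e.2
      ⟨.uncolored, (A e.1).payload⟩
  else A

namespace Label.Opposite

theorem symm {a b : Label} (h : a.Opposite b) : b.Opposite a := by
  rcases h with ⟨rfl, rfl⟩ | ⟨rfl, rfl⟩ <;> simp [Label.Opposite]

theorem left_ne {a b : Label} (h : a.Opposite b) : a ≠ .uncolored := by
  rcases h with ⟨rfl, rfl⟩ | ⟨rfl, rfl⟩ <;> simp

theorem right_ne {a b : Label} (h : a.Opposite b) : b ≠ .uncolored := h.symm.left_ne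

theorem ne {a b : Label} (h : a.Opposite b) : a ≠ b := by
  rcases h with ⟨rfl, rfl⟩ | ⟨rfl, rfl⟩ <;> simp

end Label.Opposite

section Swapping

variable {n w : ℕ}

theorem swapStep_of_opposite {A : Fin n → Element w} {e : Fin n × Fin n}
    (h : (A e.1).label.Opposite (A e.2).label) :
    swapStep A e = Function.update (Function.update A e.1 ⟨.uncolored, (A e.2).payload⟩) e.2
      ⟨.uncolored, (A e.1).payload⟩ :=
  if_pos h

theorem swapStep_of_not_opposite {A : Fin n → Element w} {e : Fin n × Fin n}
    (h : ¬ (A e.1).label.Opposite (A e.2).label) : swapStep A e = A :=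
  if_neg h

theorem LegalSwap.refl (I : Fin n → Element w) : LegalSwap I I :=
  ⟨0, Fin.elim0, Fin.elim0, by rintro (k | k) <;> exact k.elim0, fun k => k.elim0,
    fun k => k.elim0, fun k => k.elim0, fun _ _ => rfl⟩

/-- Positions swapped earlier are uncolored, so a newly swapped pair avoids them, still holds its
input elements, and can join the list of pairs. -/
theorem LegalSwap.swapStep {I O : Fin n → Element w} (h : LegalSwap I O) (e : Fin n × Fin n) :
    LegalSwap I (swapStep O e) := by
  obtain ⟨a, b⟩ := e
  unfold _root_.swapStep
  split_ifs with hop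
  swap
  · exact h
  obtain ⟨l, i, j, hinj, hopp, hi, hj, hrest⟩ := h
  dsimp only at hop ⊢
  have hab : a ≠ b := fun h => hop.ne (by rw [h])
  have ha : ∀ k, a ≠ i k ∧ a ≠ j k := fun k =>
    ⟨fun h => hop.left_ne (by rw [h, hi]), fun h => hop.left_ne (by rw [h, hj])⟩
  have hb : ∀ k, b ≠ i k ∧ b ≠ j k := fun k =>
    ⟨fun h => hop.right_ne (by rw [h, hi]), fun h => hop.right_ne (by rw [h, hj])⟩
  have hOa := hrest a ha
  have hOb := hrest b hb
  rw [Sum.elim_injective] at hinj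
  obtain ⟨hii, hjj, hij⟩ := hinj
  refine ⟨l + 1, Fin.cons a i, Fin.cons b j, ?_, ?_, ?_, ?_, ?_⟩
  · rw [Sum.elim_injective]
    refine ⟨Fin.cons_injective_iff.2 ⟨?_, hii⟩, Fin.cons_injective_iff.2 ⟨?_, hjj⟩, ?_⟩
    · rintro ⟨k, hk⟩
      exact (ha k).1 hk.symm
    · rintro ⟨k, hk⟩
      exact (hb k).2 hk.symm
    · intro p q
      refine Fin.cases ?_ (fun p => ?_) p <;> refine Fin.cases ?_ (fun q => ?_) q
      · simpa using hab
      · simpa using (ha q).2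
      · simpa using (hb p).1.symm
      · simpa using hij p q
  · refine Fin.cases ?_ fun k => ?_
    · simpa [← hOa, ← hOb] using hop
    · simpa using hopp k
  · refine Fin.cases ?_ fun k => ?_
    · simp [hab, hOb]
    · simp [(ha k).1.symm, (hb k).1.symm, hi]
  · refine Fin.cases ?_ fun k => ?_
    · simp [hOa]
    · simp [(ha k).2.symm, (hb k).2.symm, hj]
  · intro m hm
    have h0 := hm 0
    simp only [Fin.cons_zero] at h0
    rw [Function.update_of_ne h0.2, Function.update_of_ne h0.1]
    exact hrest m fun k => by simpa using hm k.succ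

theorem LegalSwap.foldl_swapStep {I O : Fin n → Element w} (h : LegalSwap I O)
    (L : List (Fin n × Fin n)) : LegalSwap I (L.foldl _root_.swapStep O) := by
  induction L generalizing O with
  | nil => exact h
  | cons e L ih => exact ih (h.swapStep e)

theorem filter_label_update {A : Fin n → Element w} {a b : Fin n} {c : Label}
    (hc : c ≠ .uncolored) (p q : BitVec w) :
    (Finset.univ.filter fun m =>
      (Function.update (Function.update A a ⟨.uncolored, p⟩) b ⟨.uncolored, q⟩ m).label = c) =
      ((Finset.univ.filter fun m => (A m).label = c).erase a).erase b := by
  ext m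
  simp only [Finset.mem_filter, Finset.mem_univ, true_and, Finset.mem_erase]
  rcases eq_or_ne m b with rfl | hb
  · simp [hc.symm]
  rcases eq_or_ne m a with rfl | ha
  · simp [hb, hc.symm]
  · simp [ha, hb]

theorem numLabel_red_eq_blue_swapStep {A : Fin n → Element w}
    (h : numLabel .red A = numLabel .blue A) (e : Fin n × Fin n) :
    numLabel .red (swapStep A e) = numLabel .blue (swapStep A e) := by
  obtain ⟨a, b⟩ := e
  unfold swapStep
  split_ifs with hop
  swap
  · exact h
  unfold numLabel at h ⊢
  rw [filter_label_update (by simp), filter_label_update (by simp)]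
  rcases hop with ⟨ha, hb⟩ | ⟨ha, hb⟩ <;> dsimp only at ha hb
  · rw [Finset.erase_eq_of_notMem (a := a) (by simp [ha]), Finset.card_erase_of_mem (by simp [hb]),
      Finset.erase_eq_of_notMem (a := b) (by simp [hb]), Finset.card_erase_of_mem (by simp [ha]), h]
  · rw [Finset.erase_eq_of_notMem (a := b) (by simp [hb]), Finset.card_erase_of_mem (by simp [ha]),
      Finset.erase_eq_of_notMem (a := a) (by simp [ha]), Finset.card_erase_of_mem (by simp [hb]), h]

theorem numLabel_red_eq_blue_foldl {A : Fin n → Element w}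
    (h : numLabel .red A = numLabel .blue A) (L : List (Fin n × Fin n)) :
    numLabel .red (L.foldl swapStep A) = numLabel .blue (L.foldl swapStep A) := by
  induction L generalizing A with
  | nil => exact h
  | cons e L ih => exact ih (numLabel_red_eq_blue_swapStep h e)

theorem label_swapStep (A : Fin n → Element w) (e : Fin n × Fin n) (m : Fin n) :
    (swapStep A e m).label = .uncolored ∨ (swapStep A e m).label = (A m).label := by
  unfold swapStep
  split_ifs
  · rcases eq_or_ne m e.2 with rfl | hb
    · simp
    rcases eq_or_ne m e.1 with rfl | ha
    · simp [hb]
    · simp [ha, hb]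
  · simp

theorem not_opposite_swapStep {A : Fin n → Element w} {a b : Fin n}
    (h : ¬ (A a).label.Opposite (A b).label) (e : Fin n × Fin n) :
    ¬ (swapStep A e a).label.Opposite (swapStep A e b).label := by
  intro hop
  rw [(label_swapStep A e a).resolve_left hop.left_ne,
    (label_swapStep A e b).resolve_left hop.right_ne] at hop
  exact h hop

theorem not_opposite_swapStep_self (A : Fin n → Element w) (e : Fin n × Fin n) :
    ¬ (swapStep A e e.1).label.Opposite (swapStep A e e.2).label := by
  intro hop
  unfold swapStep at hop
  split_ifs at hop with h
  · exact hop.right_ne (by simp)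
  · exact h hop

theorem not_opposite_foldl {A : Fin n → Element w} {a b : Fin n}
    (h : ¬ (A a).label.Opposite (A b).label) (L : List (Fin n × Fin n)) :
    ¬ (L.foldl swapStep A a).label.Opposite (L.foldl swapStep A b).label := by
  induction L generalizing A with
  | nil => exact h
  | cons e L ih => exact ih (not_opposite_swapStep h e)

theorem not_opposite_foldl_of_mem (A : Fin n → Element w) {L : List (Fin n × Fin n)}
    {e : Fin n × Fin n} (he : e ∈ L) :
    ¬ (L.foldl swapStep A e.1).label.Opposite (L.foldl swapStep A e.2).label := by
  induction L generalizing A with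
  | nil => simp at he
  | cons f L ih =>
    rcases List.mem_cons.1 he with rfl | he
    · exact not_opposite_foldl (not_opposite_swapStep_self A e) L
    · exact ih _ he

theorem numColored_eq_add (A : Fin n → Element w) :
    numColored A = numLabel .red A + numLabel .blue A := by
  unfold numColored numLabel
  rw [← Finset.card_union_of_disjoint]
  · congr 1
    ext m
    simp only [Finset.mem_filter, Finset.mem_univ, true_and, Finset.mem_union]
    cases (A m).label <;> simp
  · rw [Finset.disjoint_filter]
    intro m _ h
    simp [h]

/-! ### The circuit -/

/-- The circuit that performs `swapStep` along a list of pairs, where `bit` and `pay` are the wires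
that hold the current array. For each pair, two boolean gates decide whether to swap and uncolor
it, and two selector gates move the payloads. -/
def swapCircuit : List (Fin n × Fin n) → {β π : Type} → (Fin n × Fin 2 → β) → (Fin n → π) →
    Circuit (Fin n × Fin 2) (Fin n) β π
  | [], _, _, bit, pay => .output bit pay
  | e :: L, _, _, bit, pay =>
    -- The swap condition depends on four bits, one too many for a gate; the second gate brings in
    -- the last one.
    .bool 3 1 le_rfl (by norm_num) ![bit (e.1, 0), bit (e.1, 1), bit (e.2, 1)]
      (fun v _ => v 0 && (v 1 ^^ v 2)) <|
    .bool 3 3 le_rfl le_rfl ![.inr 0, .inl (bit (e.1, 0)), .inl (bit (e.2, 0))]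
      (fun v => ![v 0 && v 2, v 1 && !(v 0 && v 2), v 2 && !(v 0 && v 2)]) <|
    .selector (.inr 0) (pay e.1) (pay e.2) <|
    .selector (.inr 0) (.inl (pay e.2)) (.inl (pay e.1)) <|
    swapCircuit L
      -- Clearing the first label bit uncolors an element, so color bits keep their wires.
      (Function.update (Function.update (fun p => .inl (.inl (bit p))) (e.1, 0) (.inr 1))
        (e.2, 0) (.inr 2))
      (Function.update (Function.update (fun m => .inl (.inl (pay m))) e.1 (.inl (.inr 0)))
        e.2 (.inr 0))

theorem numBool_swapCircuit (L : List (Fin n × Fin n)) {β π : Type} (bit : Fin n × Fin 2 → β)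
    (pay : Fin n → π) : (swapCircuit L bit pay).numBool = 2 * L.length := by
  induction L generalizing β π with
  | nil => rfl
  | cons e L ih => simp only [swapCircuit, Circuit.numBool, ih, List.length_cons]; omega

theorem numSelector_swapCircuit (L : List (Fin n × Fin n)) {β π : Type} (bit : Fin n × Fin 2 → β)
    (pay : Fin n → π) : (swapCircuit L bit pay).numSelector = 2 * L.length := by
  induction L generalizing β π with
  | nil => rfl
  | cons e L ih => simp only [swapCircuit, Circuit.numSelector, ih, List.length_cons]; omega

theorem opposite_ofBits_iff (c d c' d' : Bool) :
    (Label.ofBits c d).Opposite (Label.ofBits c' d') ↔ (c && (d ^^ d') && c') = true := by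
  cases c <;> cases d <;> cases c' <;> cases d' <;> simp [Label.Opposite, Label.ofBits]

/-- Arbitrary wire assignments are allowed because every gate enlarges the wire types in the
induction. -/
theorem arrayOf_eval_swapCircuit (L : List (Fin n × Fin n)) {β π : Type} (bit : Fin n × Fin 2 → β)
    (pay : Fin n → π) (x : β → Bool) (y : π → BitVec w) :
    arrayOf ((swapCircuit L bit pay).eval x y) =
      L.foldl swapStep (arrayOf (x ∘ bit, y ∘ pay)) := by
  induction L generalizing β π with
  | nil => rfl
  | cons e L ih =>
    obtain ⟨a, b⟩ := e
    rw [List.foldl_cons]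
    simp only [swapCircuit, Circuit.eval]
    rw [ih]
    congr 1
    by_cases h : (x (bit (a, 0)) && (x (bit (a, 1)) ^^ x (bit (b, 1))) && x (bit (b, 0))) = true
    · rw [swapStep_of_opposite ((opposite_ofBits_iff _ _ _ _).2 h)]
      funext m
      have hab : a ≠ b := by
        rintro rfl
        simp at h
      simp only [Bool.and_eq_true] at h
      obtain ⟨⟨h1, h2⟩, h3⟩ := h
      rcases eq_or_ne m b with rfl | hb
      · simp [arrayOf, h1, h2, h3, Label.ofBits]
      rcases eq_or_ne m a with rfl | ha
      · simp [arrayOf, h1, h2, h3, hb, Label.ofBits]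
      · simp [arrayOf, ha, hb]
    · rw [swapStep_of_not_opposite (mt (opposite_ofBits_iff _ _ _ _).1 h)]
      funext m
      rw [Bool.not_eq_true] at h
      rcases eq_or_ne m b with rfl | hb
      · simp [arrayOf, h]
      rcases eq_or_ne m a with rfl | ha
      · simp [arrayOf, h, hb]
      · simp [arrayOf, ha, hb]

end Swapping

/-! ### Few colored elements remain -/

theorem isLooseSwapper_swapCircuit {n w : ℕ} {L : List (Fin n × Fin n)}
    (hL : ∀ A B : Finset (Fin n), A.Nonempty → n ≤ 256 * A.card → n ≤ 256 * B.card →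
      ∃ e ∈ L, e.1 ∈ A ∧ e.2 ∈ B) : IsLooseSwapper n w (swapCircuit L id id) := by
  intro x y hxy
  rw [arrayOf_eval_swapCircuit]
  simp only [Function.comp_id]
  refine ⟨(LegalSwap.refl _).foldl_swapStep L, ?_⟩
  have heq := numLabel_red_eq_blue_foldl hxy L
  have hcol := numColored_eq_add (L.foldl swapStep (arrayOf (x, y)))
  suffices h : 128 * numColored (L.foldl swapStep (arrayOf (x, y))) ≤ n by
    rw [le_div_iff₀ (by norm_num), mul_comm]
    exact_mod_cast h
  by_contra! hlt
  -- Red is exactly half of the colored elements, hence `256 = 2 * 128`.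
  have hred : n < 256 * numLabel .red (L.foldl swapStep (arrayOf (x, y))) := by omega
  obtain ⟨e, he, h1, h2⟩ := hL _ _ (Finset.card_pos.1 (by unfold numLabel at hred; omega)) hred.le
    (heq ▸ hred.le)
  exact not_opposite_foldl_of_mem _ he (Or.inr ⟨(Finset.mem_filter.1 h1).2,
    (Finset.mem_filter.1 h2).2⟩)

theorem mainTheorem8 :
    ∃ C₁ C₂ : ℕ, ∀ n w : ℕ,
      ∃ Γ : Circuit (Fin n × Fin 2) (Fin n) (Fin n × Fin 2) (Fin n),
        Γ.numBool ≤ C₁ * n ∧ Γ.numSelector ≤ C₂ * n ∧ IsLooseSwapper n w Γ := by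
  -- Two gates of each kind for each of the `2 * 256 ^ 2 * n` pairs.
  refine ⟨2 * (2 * 256 ^ 2), 2 * (2 * 256 ^ 2), fun n w => ?_⟩
  obtain ⟨L, hlen, hL⟩ := exists_list_meets_large_sets 256 (by norm_num) n
  refine ⟨swapCircuit L id id, ?_, ?_, isLooseSwapper_swapCircuit hL⟩
  · rw [numBool_swapCircuit, hlen, ← mul_assoc]
  · rw [numSelector_swapCircuit, hlen, ← mul_assoc]
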